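/- Let $n \ge 3$ and $2 \le k \le n-1$, and let $\mathcal{I}$ be the set of all $k$-element subsets of $\{1,\dots,n\}$. For $I \in \mathcal{I}$ let $\mathbb{Z}^k_I \subset \mathbb{Z}^n$ be the set of integer linear combinations of the canonical vectors $e_i$, $i \in I$, and let $\pi_I : \mathbb{Z}^n \to \mathbb{Z}^k_I$ be the orthogonal projection. Given parameters $\mathbf{p} = (p_I)_{I \in \mathcal{I}} \in [0,1]^{\mathcal{I}}$, let $\omega_I = (\omega_I(u))_{u \in \mathbb{Z}^k_I}$, $I \in \mathcal{I}$, be independent Bernoulli site percolations: for each $I$ the variables $\omega_I(u) \in \{0,1\}$ are i.i.d. with mean $p_I$. Bernoulli $(n,k)$-hyperplane percolation is the random configuration $\omega(v) = \prod_{I \in \mathcal{I}} \omega_I(\pi_I(v))$, $v \in \mathbb{Z}^n$; let $\mathbb{P}_{\mathbf{p}}$ be its law on $\{0,1\}^{\mathbb{Z}^n}$. A site $v$ is open if $\omega(v) = 1$. Let $[o \leftrightarrow \infty]$ be the event that the origin $o$ belongs to an infinite connected component of open sites in the nearest-neighbour lattice $\mathbb{Z}^n$. Then the model undergoes a non-trivial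 phase transition, i.e. there are $\mathbf{p}$ with $p_I > 0$ for all $I$ and $\mathbb{P}_{\mathbf{p}}(o \leftrightarrow \infty) = 0$, and $\mathbf{q}$ with $q_I < 1$ for all $I$ and $\mathbb{P}_{\mathbf{q}}(o \leftrightarrow \infty) > 0$. More precisely: 1. there is $\varepsilon = \varepsilon(n,k) > 0$ such that $\mathbb{P}_{\mathbf{p}}(o \leftrightarrow \infty) > 0$ for every $\mathbf{p} \in [0,1]^{\mathcal{I}}$ with $p_I > 1 - \varepsilon$ for all $I \in \mathcal{I}$; 2. there is $\varepsilon = \varepsilon(n,k) > 0$ such that $\mathbb{P}_{\mathbf{p}}(o \leftrightarrow \infty) = 0$ for every $\mathbf{p} \in [0,1]^{\mathcal{I}}$ with $p_I < \varepsilon$ for all $I \in \mathcal{I}$. -/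

import Mathlib

open MeasureTheory ProbabilityTheory

namespace HyperplanePercolation

/-- The index set of all `k`-element subsets `I` of `[n]`. -/
abbrev Index (n k : ℕ) : Type := {I : Finset (Fin n) // I.card = k}

/-- The coordinate hyperplane `ℤ^k_I` in `ℤ^n`: the integer combinations of the canonical
vectors `e_i`, `i ∈ I`, i.e. the integer vectors whose coordinates outside `I` vanish. -/
abbrev CoordPlane {n : ℕ} (I : Finset (Fin n)) : Type :=
  {x : Fin n → ℤ // ∀ i, i ∉ I → x i = 0}

/-- The orthogonal projection `π_I` of `ℤ^n` onto `ℤ^k_I`. -/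
def proj {n : ℕ} (I : Finset (Fin n)) (v : Fin n → ℤ) : CoordPlane I :=
  ⟨fun i => if i ∈ I then v i else 0, fun _ hi => if_neg hi⟩

/-- The law of Bernoulli site percolation with parameter `p` on a set of sites `S`: the
states of the sites (`true` for `1`, i.e. open; `false` for `0`, i.e. removed) are i.i.d.
and each of them is open with probability `p`. -/
noncomputable def sitePerc (S : Type) (p : unitInterval) : Measure (S → Bool) :=
  Measure.infinitePi fun _ : S => bernoulliMeasure true false p

/-- The configuration `ω(v) = ∏_I ω_I(π_I v)` on `ℤ^n`: the site `v` is open if and only if,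
for every `I`, its projection to `ℤ^k_I` is open in `ω_I`. -/
def config {n k : ℕ} (ω : (I : Index n k) → CoordPlane I.1 → Bool) : (Fin n → ℤ) → Bool :=
  fun v => decide (∀ I : Index n k, ω I (proj I.1 v) = true)

/-- The law `ℙ_𝐩` on `{0,1}^(ℤ^n)` of Bernoulli `(n,k)`-hyperplane percolation: the
processes `ω_I` are independent Bernoulli site percolations with parameters `p_I`. -/
noncomputable def law {n k : ℕ} (p : Index n k → unitInterval) :
    Measure ((Fin n → ℤ) → Bool) :=
  (Measure.pi fun I : Index n k => sitePerc (CoordPlane I.1) (p I)).map config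

/-- The `ℤ^n`-lattice: the edges join the points at distance one. -/
def lattice (n : ℕ) : SimpleGraph (Fin n → ℤ) where
  Adj x y := ∑ i, |x i - y i| = 1
  symm := ⟨fun x y h => by simpa only [abs_sub_comm] using h⟩
  loopless := ⟨fun x h => by simp at h⟩

/-- The open cluster of `x`: the sites `y` joined to `x` by a path in `ℤ^n` all of whose
sites, the endpoints included, are open. It is empty if `x` itself is not open. -/
def cluster {n : ℕ} (η : (Fin n → ℤ) → Bool) (x : Fin n → ℤ) : Set (Fin n → ℤ) :=
  {y | ∃ w : (lattice n).Walk x y, w.IsPath ∧ ∀ z ∈ w.support, η z = true}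

/-- The event that the origin belongs to an infinite open cluster. -/
def originToInfinity (n : ℕ) : Set ((Fin n → ℤ) → Bool) :=
  {η | (cluster η 0).Infinite}

/-- Bernoulli `(n,k)`-hyperplane percolation exhibits a non-trivial phase transition: there is
no percolation for some parameters that are all positive, and there is percolation with
positive probability for some parameters that are all less than `1`. -/
def NontrivialPhaseTransition (n k : ℕ) : Prop :=
  (∃ p : Index n k → unitInterval, (∀ I, 0 < p I) ∧ law p (originToInfinity n) = 0) ∧
    ∃ q : Index n k → unitInterval, (∀ I, q I < 1) ∧ 0 < law q (originToInfinity n)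

/-- The configuration depends measurably on the `ω_I`, so the push-forward in `law` is a
genuine one. -/
theorem measurable_config {n k : ℕ} :
    Measurable (config : ((I : Index n k) → CoordPlane I.1 → Bool) → (Fin n → ℤ) → Bool) := by
  refine measurable_pi_lambda _ fun v => measurable_to_bool ?_
  have h : (fun ω : (I : Index n k) → CoordPlane I.1 → Bool => config ω v) ⁻¹' {true} =
      ⋂ I : Index n k, {ω | ω I (proj I.1 v) = true} := by
    ext ω
    simp [config]
  rw [h]
  refine MeasurableSet.iInter fun I => ?_
  have hm : Measurable fun ω : (I : Index n k) → CoordPlane I.1 → Bool => ω I (proj I.1 v) :=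
    (measurable_pi_apply _).comp (measurable_pi_apply I)
  exact hm (measurableSet_singleton true)

instance (S : Type) (p : unitInterval) : IsProbabilityMeasure (sitePerc S p) := by
  unfold sitePerc
  infer_instance

instance {n k : ℕ} (p : Index n k → unitInterval) : IsProbabilityMeasure (law p) :=
  Measure.isProbabilityMeasure_map measurable_config.aemeasurable

end HyperplanePercolation

namespace HyperplanePercolation

/-! For percolation at high densities, take the two-parameter family of corners `a • (1, …, 1) + b •
(0, 1, …, n - 1)` and attach to each a cube of side `n`, called a cell, large enough to contain the
corners of the next cells in both directions. Any two coordinates of a corner determine `(a, b)`,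
so, as `k ≥ 2`, cells with distant indices use disjoint sets of variables in every plane
(`disjoint_cellSites`). Open cells thus form a finite-range dependent percolation on the quadrant,
of high density.

This percolation is handled by multiscale renormalisation instead of a contour argument. A box of `L
× L` sub-boxes is bad if it has two bad sub-boxes more than `r` apart. Independence gives the
recursion `q ↦ L ^ 4 * q ^ 2` for the probability of being bad (`measure_badBox_succ_le`), so these
probabilities are summable. In a good box the bad sub-boxes cluster together, and with `L = 2 * r +
3` adjacent good boxes share a full row or column through which they connect (`rep_connected`). If
the boxes near the origin are good at all levels, the origin is joined to cells arbitrarily far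
away.

At low densities, an infinite cluster is unbounded in some coordinate `i`, and its projection to a
plane with `i ∈ I` contains open self-avoiding paths of every length (`exists_plane_paths`). A
Peierls count of at most `(2n) ^ m` paths excludes this when every `p_I < 1 / (4n)`. -/

/-- Two boxes of the quadrant are far apart if some coordinates differ by more than `r`. -/
def Far (r : ℕ) (s t : ℕ × ℕ) : Prop :=
  s.1 + r < t.1 ∨ t.1 + r < s.1 ∨ s.2 + r < t.2 ∨ t.2 + r < s.2

/-- The sub-box in position `s` of the box `x`, in a subdivision into `L × L` sub-boxes. -/
def child (L : ℕ) (x s : ℕ × ℕ) : ℕ × ℕ := (L * x.1 + s.1, L * x.2 + s.2)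

/-- Two sets of numbers of diameter at most `r` do not cover the numbers below `2 * r + 3`. -/
theorem exists_lt_not_or {r : ℕ} {P Q : ℕ → Prop}
    (hP : ∀ i j, i < 2 * r + 3 → j < 2 * r + 3 → i + r < j → ¬ P i ∨ ¬ P j)
    (hQ : ∀ i j, i < 2 * r + 3 → j < 2 * r + 3 → i + r < j → ¬ Q i ∨ ¬ Q j) :
    ∃ i < 2 * r + 3, ¬ P i ∧ ¬ Q i := by
  -- The points `0`, `r + 1`, `2 * r + 2` are pairwise more than `r` apart, so each of `P`, `Q`
  -- holds at no more than one of them, and one point is free of both.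
  have a1 := hP 0 (r + 1) (by omega) (by omega) (by omega)
  have a2 := hP 0 (2 * r + 2) (by omega) (by omega) (by omega)
  have a3 := hP (r + 1) (2 * r + 2) (by omega) (by omega) (by omega)
  have b1 := hQ 0 (r + 1) (by omega) (by omega) (by omega)
  have b2 := hQ 0 (2 * r + 2) (by omega) (by omega) (by omega)
  have b3 := hQ (r + 1) (2 * r + 2) (by omega) (by omega) (by omega)
  by_cases h0 : ¬ P 0 ∧ ¬ Q 0
  · exact ⟨0, by omega, h0⟩
  by_cases h1 : ¬ P (r + 1) ∧ ¬ Q (r + 1)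
  · exact ⟨r + 1, by omega, h1⟩
  exact ⟨2 * r + 2, by omega, by tauto⟩

/-- A chain of consecutively related points is related throughout. -/
theorem chain_of_equivalence {α : Type*} {C : α → α → Prop} (hC : Equivalence C) {L : ℕ}
    {f : ℕ → α} (h : ∀ i, i + 1 < L → C (f i) (f (i + 1))) :
    ∀ i j, i < L → j < L → C (f i) (f j) := by
  have key : ∀ j, j < L → C (f 0) (f j) := by
    intro j
    induction j with
    | zero => exact fun _ => hC.refl _
    | succ j ih => exact fun hj => hC.trans (ih (by omega)) (h j hj)
  exact fun i j hi hj => hC.trans (hC.symm (key i hi)) (key j hj)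

/-! ### Deterministic connectivity of good boxes across scales. -/

section Renormalisation

variable (L : ℕ) (G : ℕ → ℕ × ℕ → Prop)

/-- All sub-boxes in column `i` of the box `x` of level `N + 1` are good. -/
def FullColumn (N : ℕ) (x : ℕ × ℕ) (i : ℕ) : Prop := ∀ j < L, G N (child L x (i, j))

/-- All sub-boxes in row `j` of the box `x` of level `N + 1` are good. -/
def FullRow (N : ℕ) (x : ℕ × ℕ) (j : ℕ) : Prop := ∀ i < L, G N (child L x (i, j))

/-- A representative cell of a box, taken at the crossing of a full column and a full row. -/
noncomputable def rep : ℕ → ℕ × ℕ → ℕ × ℕ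
  | 0, x => x
  -- The choices are arbitrary when no full column or row exists; they are meaningful for good
  -- boxes.
  | N + 1, x => rep N (child L x
      (Classical.epsilon fun i => i < L ∧ FullColumn L G N x i,
        Classical.epsilon fun j => j < L ∧ FullRow L G N x j))

variable {L G} {r : ℕ}

/-- Bad sub-boxes in rows more than `r` apart would be far, so the non-full rows of a good box have
diameter at most `r`; two such sets cannot exhaust `2 * r + 3` rows. -/
theorem exists_common_fullRow (hL : L = 2 * r + 3)
    (hG : ∀ N x, G (N + 1) x → ∀ s t : ℕ × ℕ, s.1 < L → s.2 < L → t.1 < L → t.2 < L →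
      Far r s t → G N (child L x s) ∨ G N (child L x t))
    {N : ℕ} {x y : ℕ × ℕ} (hx : G (N + 1) x) (hy : G (N + 1) y) :
    ∃ j < L, FullRow L G N x j ∧ FullRow L G N y j := by
  have key : ∀ z, G (N + 1) z → ∀ i j, i < 2 * r + 3 → j < 2 * r + 3 → i + r < j →
      ¬ ¬ FullRow L G N z i ∨ ¬ ¬ FullRow L G N z j := by
    intro z hz i j hi hj hij
    by_contra! h
    simp only [FullRow, not_forall] at h
    obtain ⟨⟨a, ha, ha'⟩, ⟨b, hb, hb'⟩⟩ := h
    rcases hG N z hz (a, i) (b, j) ha (by omega) hb (by omega) (by simp [Far]; omega) with h | h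
    · exact ha' h
    · exact hb' h
  obtain ⟨j, hj, h1, h2⟩ := exists_lt_not_or (key x hx) (key y hy)
  exact ⟨j, hL ▸ hj, not_not.1 h1, not_not.1 h2⟩

theorem exists_common_fullColumn (hL : L = 2 * r + 3)
    (hG : ∀ N x, G (N + 1) x → ∀ s t : ℕ × ℕ, s.1 < L → s.2 < L → t.1 < L → t.2 < L →
      Far r s t → G N (child L x s) ∨ G N (child L x t))
    {N : ℕ} {x y : ℕ × ℕ} (hx : G (N + 1) x) (hy : G (N + 1) y) :
    ∃ i < L, FullColumn L G N x i ∧ FullColumn L G N y i := by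
  have key : ∀ z, G (N + 1) z → ∀ i j, i < 2 * r + 3 → j < 2 * r + 3 → i + r < j →
      ¬ ¬ FullColumn L G N z i ∨ ¬ ¬ FullColumn L G N z j := by
    intro z hz i j hi hj hij
    by_contra! h
    simp only [FullColumn, not_forall] at h
    obtain ⟨⟨a, ha, ha'⟩, ⟨b, hb, hb'⟩⟩ := h
    rcases hG N z hz (i, a) (j, b) (by omega) ha (by omega) hb (by simp [Far]; omega) with h | h
    · exact ha' h
    · exact hb' h
  obtain ⟨j, hj, h1, h2⟩ := exists_lt_not_or (key x hx) (key y hy)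
  exact ⟨j, hL ▸ hj, not_not.1 h1, not_not.1 h2⟩

variable {C : ℕ × ℕ → ℕ × ℕ → Prop}

/-- Neighbouring good boxes have connected representatives. -/
theorem rep_connected (hL : L = 2 * r + 3)
    (hG : ∀ N x, G (N + 1) x → ∀ s t : ℕ × ℕ, s.1 < L → s.2 < L → t.1 < L → t.2 < L →
      Far r s t → G N (child L x s) ∨ G N (child L x t))
    (hC : Equivalence C)
    (h1 : ∀ a b, G 0 (a, b) → G 0 (a + 1, b) → C (a, b) (a + 1, b))
    (h2 : ∀ a b, G 0 (a, b) → G 0 (a, b + 1) → C (a, b) (a, b + 1)) (N : ℕ) :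
    (∀ a b, G N (a, b) → G N (a + 1, b) → C (rep L G N (a, b)) (rep L G N (a + 1, b))) ∧
    (∀ a b, G N (a, b) → G N (a, b + 1) → C (rep L G N (a, b)) (rep L G N (a, b + 1))) := by
  induction N with
  | zero => exact ⟨h1, h2⟩
  | succ N ih =>
    obtain ⟨ih1, ih2⟩ := ih
    have col : ∀ x i, FullColumn L G N x i → ∀ j j', j < L → j' < L →
        C (rep L G N (child L x (i, j))) (rep L G N (child L x (i, j'))) := by
      intro x i hi
      refine chain_of_equivalence hC (f := fun j => rep L G N (child L x (i, j))) fun j hj => ?_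
      exact ih2 _ _ (hi j (by omega)) (hi (j + 1) hj)
    have row : ∀ x j, FullRow L G N x j → ∀ i i', i < L → i' < L →
        C (rep L G N (child L x (i, j))) (rep L G N (child L x (i', j))) := by
      intro x j hj
      refine chain_of_equivalence hC (f := fun i => rep L G N (child L x (i, j))) fun i hi => ?_
      exact ih1 _ _ (hj i (by omega)) (hj (i + 1) hi)
    have spec : ∀ x, G (N + 1) x → ∃ i j, i < L ∧ j < L ∧ FullColumn L G N x i ∧
        FullRow L G N x j ∧ rep L G (N + 1) x = rep L G N (child L x (i, j)) := by
      intro x hx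
      obtain ⟨i, hi, hi', -⟩ := exists_common_fullColumn hL hG hx hx
      obtain ⟨j, hj, hj', -⟩ := exists_common_fullRow hL hG hx hx
      have e1 := Classical.epsilon_spec (p := fun i => i < L ∧ FullColumn L G N x i) ⟨i, hi, hi'⟩
      have e2 := Classical.epsilon_spec (p := fun j => j < L ∧ FullRow L G N x j) ⟨j, hj, hj'⟩
      exact ⟨_, _, e1.1, e2.1, e1.2, e2.2, rfl⟩
    constructor
    · intro a b ha hb
      obtain ⟨i, j, hi, hj, ci, -, e⟩ := spec _ ha
      obtain ⟨i', j', hi', hj', ci', -, e'⟩ := spec _ hb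
      obtain ⟨t, ht, r1, r2⟩ := exists_common_fullRow hL hG ha hb
      rw [e, e']
      -- Follow the full column to the common full row `t`, that row up to the shared side, cross
      -- it, then row `t` and the full column of the other box.
      refine hC.trans (col _ i ci j t hj ht) (hC.trans (row _ t r1 i (L - 1) hi (by omega))
        (hC.trans ?_ (hC.trans (row _ t r2 0 i' (by omega) hi') (col _ i' ci' t j' ht hj'))))
      have q1 := r1 (L - 1) (by omega)
      have q2 := r2 0 (by omega)
      have : child L (a + 1, b) (0, t) = (L * a + (L - 1) + 1, L * b + t) := by
        simp only [child, Prod.mk.injEq, and_true, mul_add]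
        omega
      rw [this] at q2 ⊢
      exact ih1 _ _ q1 q2
    · intro a b ha hb
      obtain ⟨i, j, hi, hj, -, ri, e⟩ := spec _ ha
      obtain ⟨i', j', hi', hj', -, ri', e'⟩ := spec _ hb
      obtain ⟨t, ht, r1, r2⟩ := exists_common_fullColumn hL hG ha hb
      rw [e, e']
      refine hC.trans (row _ j ri i t hi ht) (hC.trans (col _ t r1 j (L - 1) hj (by omega))
        (hC.trans ?_ (hC.trans (col _ t r2 0 j' (by omega) hj') (row _ j' ri' t i' ht hi'))))
      have q1 := r1 (L - 1) (by omega)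
      have q2 := r2 0 (by omega)
      have : child L (a, b + 1) (t, 0) = (L * a + t, L * b + (L - 1) + 1) := by
        simp only [child, Prod.mk.injEq, true_and, mul_add]
        omega
      rw [this] at q2 ⊢
      exact ih2 _ _ q1 q2

/-- If the origin's box is good at every level, with all its neighbours in the parent box, then
the origin is connected to the representatives of these neighbours. -/
theorem origin_connected_rep (hL : L = 2 * r + 3)
    (hG : ∀ N x, G (N + 1) x → ∀ s t : ℕ × ℕ, s.1 < L → s.2 < L → t.1 < L → t.2 < L →
      Far r s t → G N (child L x s) ∨ G N (child L x t))
    (hC : Equivalence C)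
    (h1 : ∀ a b, G 0 (a, b) → G 0 (a + 1, b) → C (a, b) (a + 1, b))
    (h2 : ∀ a b, G 0 (a, b) → G 0 (a, b + 1) → C (a, b) (a, b + 1))
    (h0 : ∀ N i j, i < L → j < L → G N (i, j)) (N : ℕ) :
    ∀ i j, i < L → j < L → C (0, 0) (rep L G N (i, j)) := by
  have all : ∀ N i j, i < L → j < L → C (rep L G N (0, 0)) (rep L G N (i, j)) := by
    intro N i j hi hj
    obtain ⟨c1, c2⟩ := rep_connected hL hG hC h1 h2 N
    refine hC.trans (chain_of_equivalence hC (L := L) (f := fun i => rep L G N (i, 0))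
      (fun i hi => c1 i 0 (h0 N _ _ (by omega) (by omega)) (h0 N _ _ hi (by omega))) 0 i
      (by omega) hi) (chain_of_equivalence hC (L := L) (f := fun j => rep L G N (i, j))
      (fun j hj => c2 i j (h0 N _ _ hi (by omega)) (h0 N _ _ hi hj)) 0 j (by omega) hj)
  induction N with
  | zero => exact all 0
  | succ N ih =>
    intro i j hi hj
    refine hC.trans ?_ (all (N + 1) i j hi hj)
    -- Column and row `0` only show that the choices in `rep` are valid; whichever child is chosen,
    -- the induction hypothesis reaches its representative.
    have f1 : FullColumn L G N (0, 0) 0 := fun j hj => by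
      simpa [child] using h0 N 0 j (by omega) hj
    have f2 : FullRow L G N (0, 0) 0 := fun j hj => by
      simpa [child] using h0 N j 0 hj (by omega)
    have e1 := Classical.epsilon_spec (p := fun i => i < L ∧ FullColumn L G N (0, 0) i)
      ⟨0, by omega, f1⟩
    have e2 := Classical.epsilon_spec (p := fun j => j < L ∧ FullRow L G N (0, 0) j)
      ⟨0, by omega, f2⟩
    simpa [rep, child] using ih _ _ e1.1 e2.1

/-- The representative of a box of level `N` lies in that box. -/
theorem rep_mem_box (N : ℕ) :
    ∀ x, L ^ N * x.1 ≤ (rep L G N x).1 := by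
  induction N with
  | zero => simp [rep]
  | succ N ih =>
    intro x
    refine le_trans ?_ (ih _)
    rw [pow_succ, mul_assoc]
    exact Nat.mul_le_mul_left _ (by simp [child])

end Renormalisation

/-! ### Probability estimates for bad boxes. -/

section RenormalisationProbability

open scoped ENNReal

variable {Ω J : Type*}

/-- The event that the box `x` of level `N` is bad: a box of level `0` is a cell and `A` tells
when it is bad, a box of level `N + 1` is bad if two far apart sub-boxes are bad. -/
def badBox (r L : ℕ) (A : ℕ × ℕ → Set Ω) : ℕ → ℕ × ℕ → Set Ω
  | 0, x => A x
  | N + 1, x => ⋃ s ∈ Finset.range L ×ˢ Finset.range L, ⋃ t ∈ Finset.range L ×ˢ Finset.range L,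
      {ω | Far r s t ∧ ω ∈ badBox r L A N (child L x s) ∧ ω ∈ badBox r L A N (child L x t)}

/-- The variables on which the state of a box depends. -/
def region (L : ℕ) (S : ℕ × ℕ → Set J) : ℕ → ℕ × ℕ → Set J
  | 0, x => S x
  | N + 1, x => {i | ∃ s : ℕ × ℕ, s.1 < L ∧ s.2 < L ∧ i ∈ region L S N (child L x s)}

theorem not_mem_badBox_succ {r L : ℕ} {A : ℕ × ℕ → Set Ω} {ω : Ω} (N : ℕ) (x : ℕ × ℕ)
    (h : ω ∉ badBox r L A (N + 1) x) (s t : ℕ × ℕ) (hs1 : s.1 < L) (hs2 : s.2 < L)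
    (ht1 : t.1 < L) (ht2 : t.2 < L) (hst : Far r s t) :
    ω ∉ badBox r L A N (child L x s) ∨ ω ∉ badBox r L A N (child L x t) := by
  by_contra! h'
  refine h ?_
  simp only [badBox, Set.mem_iUnion]
  exact ⟨s, by simp [hs1, hs2], t, by simp [ht1, ht2], hst, h'⟩

/-- An index gap of at least `r + 1` becomes at least `L * (r + 1) - (L - 1) > r`, so one range of
dependence serves all levels. -/
theorem Far.child {r L : ℕ} {x y s t : ℕ × ℕ} (h : Far r x y) (hs1 : s.1 < L) (hs2 : s.2 < L)
    (ht1 : t.1 < L) (ht2 : t.2 < L) :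
    Far r (HyperplanePercolation.child L x s) (HyperplanePercolation.child L y t) := by
  have key : ∀ a b c d : ℕ, c < L → a + r < b → L * a + c + r < L * b + d := by
    intro a b c d hc hab
    obtain ⟨e, rfl⟩ : ∃ e, b = a + r + 1 + e := ⟨b - (a + r + 1), by omega⟩
    have : r ≤ L * r := Nat.le_mul_of_pos_left _ (by omega)
    simp only [mul_add, mul_one]
    omega
  rcases h with h | h | h | h
  · exact Or.inl (key _ _ _ _ hs1 h)
  · exact Or.inr (Or.inl (key _ _ _ _ ht1 h))
  · exact Or.inr (Or.inr (Or.inl (key _ _ _ _ hs2 h)))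
  · exact Or.inr (Or.inr (Or.inr (key _ _ _ _ ht2 h)))

theorem Far.child_same {r L : ℕ} {x s t : ℕ × ℕ} (h : Far r s t) :
    Far r (HyperplanePercolation.child L x s) (HyperplanePercolation.child L x t) := by
  simp only [Far, HyperplanePercolation.child] at h ⊢
  omega

theorem disjoint_region {r L : ℕ} {S : ℕ × ℕ → Set J}
    (hS : ∀ x y, Far r x y → Disjoint (S x) (S y)) (N : ℕ) :
    ∀ x y, Far r x y → Disjoint (region L S N x) (region L S N y) := by
  induction N with
  | zero => exact hS
  | succ N ih =>
    intro x y h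
    rw [Set.disjoint_left]
    rintro i ⟨s, hs1, hs2, hs⟩ ⟨t, ht1, ht2, ht⟩
    exact Set.disjoint_left.1 (ih _ _ (h.child hs1 hs2 ht1 ht2)) hs ht

/-- Locality of bad events: combined with `disjoint_region`, it makes the states of far boxes
independent. -/
theorem measurableSet_badBox {r L : ℕ} {A : ℕ × ℕ → Set Ω} {S : ℕ × ℕ → Set J}
    {m : J → MeasurableSpace Ω} (hA : ∀ x, MeasurableSet[⨆ i ∈ S x, m i] (A x)) (N : ℕ) :
    ∀ x, MeasurableSet[⨆ i ∈ region L S N x, m i] (badBox r L A N x) := by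
  induction N with
  | zero => exact hA
  | succ N ih =>
    intro x
    have sub : ∀ s : ℕ × ℕ, s.1 < L → s.2 < L →
        MeasurableSet[⨆ i ∈ region L S (N + 1) x, m i] (badBox r L A N (child L x s)) := by
      intro s h1 h2
      exact biSup_mono (f := m) (fun i hi => (⟨s, h1, h2, hi⟩ : i ∈ region L S (N + 1) x))
        _ (ih (child L x s))
    refine Finset.measurableSet_biUnion _ fun s hs => Finset.measurableSet_biUnion _ fun t ht => ?_
    simp only [Finset.mem_product, Finset.mem_range] at hs ht
    by_cases h : Far r s t
    · simp only [h, true_and]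
      exact (sub s hs.1 hs.2).inter (sub t ht.1 ht.2)
    · simp only [h, false_and, Set.ofPred_false, MeasurableSet.empty]

variable {mΩ : MeasurableSpace Ω} {μ : Measure Ω}

theorem measure_badBox_succ_le {r L : ℕ} {A : ℕ × ℕ → Set Ω} {S : ℕ × ℕ → Set J}
    {m : J → MeasurableSpace Ω} (hm : ∀ i, m i ≤ mΩ) (hind : iIndep m μ)
    (hA : ∀ x, MeasurableSet[⨆ i ∈ S x, m i] (A x))
    (hS : ∀ x y, Far r x y → Disjoint (S x) (S y)) {N : ℕ} {q : ℝ≥0∞}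
    (hq : ∀ x, μ (badBox r L A N x) ≤ q) (x : ℕ × ℕ) :
    μ (badBox r L A (N + 1) x) ≤ (L : ℝ≥0∞) ^ 4 * q ^ 2 := by
  have pair : ∀ s t, μ {ω | Far r s t ∧ ω ∈ badBox r L A N (child L x s) ∧
      ω ∈ badBox r L A N (child L x t)} ≤ q ^ 2 := by
    intro s t
    by_cases h : Far r s t
    · simp only [h, true_and]
      have hi := indep_iSup_of_disjoint hm hind
        (disjoint_region (L := L) hS N _ _ (h.child_same (L := L) (x := x)))
      rw [Indep_iff] at hi
      refine (hi _ _ (measurableSet_badBox hA N _) (measurableSet_badBox hA N _)).le.trans ?_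
      rw [sq]
      exact mul_le_mul' (hq _) (hq _)
    · simp [h]
  calc μ (badBox r L A (N + 1) x)
      ≤ ∑ s ∈ Finset.range L ×ˢ Finset.range L, ∑ t ∈ Finset.range L ×ˢ Finset.range L, q ^ 2 := by
        refine (measure_biUnion_finset_le _ _).trans (Finset.sum_le_sum fun s _ => ?_)
        exact (measure_biUnion_finset_le _ _).trans (Finset.sum_le_sum fun t _ => pair s t)
    _ = (L : ℝ≥0∞) ^ 4 * q ^ 2 := by
        simp only [Finset.sum_const, Finset.card_product, Finset.card_range, nsmul_eq_mul,
          Nat.cast_mul]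
        ring

/-- The normalised quantity `L ^ 4 * q` is at most squared from one level to the next. The decay is
doubly exponential, but the geometric rate suffices for summability. -/
theorem measure_badBox_le {r L : ℕ} {A : ℕ × ℕ → Set Ω} {S : ℕ × ℕ → Set J}
    {m : J → MeasurableSpace Ω} (hm : ∀ i, m i ≤ mΩ) (hind : iIndep m μ)
    (hA : ∀ x, MeasurableSet[⨆ i ∈ S x, m i] (A x))
    (hS : ∀ x y, Far r x y → Disjoint (S x) (S y)) {θ : ℝ≥0∞} (hθ : θ ≤ 1)
    (hq : ∀ x, (L : ℝ≥0∞) ^ 4 * μ (A x) ≤ θ) (hL : L ≠ 0) (N : ℕ) :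
    ∀ x, (L : ℝ≥0∞) ^ 4 * μ (badBox r L A N x) ≤ θ ^ (N + 1) := by
  have hL0 : (L : ℝ≥0∞) ^ 4 ≠ 0 := by simp [hL]
  have hLt : (L : ℝ≥0∞) ^ 4 ≠ ⊤ := by simp
  induction N with
  | zero => simpa [badBox] using hq
  | succ N ih =>
    intro x
    have hq' : ∀ x, μ (badBox r L A N x) ≤ θ ^ (N + 1) / (L : ℝ≥0∞) ^ 4 := fun x => by
      rw [ENNReal.le_div_iff_mul_le (Or.inl hL0) (Or.inl hLt), mul_comm]
      exact ih x
    calc (L : ℝ≥0∞) ^ 4 * μ (badBox r L A (N + 1) x)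
        ≤ (L : ℝ≥0∞) ^ 4 * ((L : ℝ≥0∞) ^ 4 * (θ ^ (N + 1) / (L : ℝ≥0∞) ^ 4) ^ 2) := by
          gcongr
          exact measure_badBox_succ_le hm hind hA hS hq' x
      _ = ((L : ℝ≥0∞) ^ 4 * (θ ^ (N + 1) / (L : ℝ≥0∞) ^ 4)) ^ 2 := by ring
      _ = (θ ^ (N + 1)) ^ 2 := by rw [ENNReal.mul_div_cancel hL0 hLt]
      _ = θ ^ (N + 1 + 1) * θ ^ N := by ring
      _ ≤ θ ^ (N + 1 + 1) * 1 := by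
          gcongr
          exact pow_le_one₀ zero_le hθ
      _ = θ ^ (N + 1 + 1) := mul_one _

/-- With positive probability no sub-box of the origin's boxes is bad. -/
theorem measure_forall_good_pos [IsProbabilityMeasure μ] {r L : ℕ} {A : ℕ × ℕ → Set Ω}
    {S : ℕ × ℕ → Set J} {m : J → MeasurableSpace Ω} (hm : ∀ i, m i ≤ mΩ) (hind : iIndep m μ)
    (hA : ∀ x, MeasurableSet[⨆ i ∈ S x, m i] (A x))
    (hS : ∀ x y, Far r x y → Disjoint (S x) (S y))
    (hq : ∀ x, (L : ℝ≥0∞) ^ 4 * μ (A x) ≤ 3⁻¹) (hL : L ≠ 0) :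
    0 < μ {ω | ∀ N i j, i < L → j < L → ω ∉ badBox r L A N (i, j)} := by
  have hθ : (3⁻¹ : ℝ≥0∞) ≤ 1 := by simp
  have hsum : μ (⋃ N, ⋃ s ∈ Finset.range L ×ˢ Finset.range L, badBox r L A N s) < 1 := by
    have each : ∀ N, μ (⋃ s ∈ Finset.range L ×ˢ Finset.range L, badBox r L A N s) ≤
        (3⁻¹ : ℝ≥0∞) ^ (N + 1) := by
      intro N
      refine (measure_biUnion_finset_le _ _).trans ?_
      calc ∑ s ∈ Finset.range L ×ˢ Finset.range L, μ (badBox r L A N s)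
          ≤ ∑ s ∈ Finset.range L ×ˢ Finset.range L,
            (3⁻¹ : ℝ≥0∞) ^ (N + 1) / (L : ℝ≥0∞) ^ 4 := by
            refine Finset.sum_le_sum fun s _ => ?_
            rw [ENNReal.le_div_iff_mul_le (Or.inl (by simp [hL])) (Or.inl (by simp)), mul_comm]
            exact measure_badBox_le hm hind hA hS hθ hq hL N s
        _ = (L : ℝ≥0∞) ^ 2 * ((3⁻¹ : ℝ≥0∞) ^ (N + 1) / (L : ℝ≥0∞) ^ 4) := by
            simp only [Finset.sum_const, Finset.card_product, Finset.card_range, nsmul_eq_mul,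
              Nat.cast_mul, sq]
        _ ≤ (L : ℝ≥0∞) ^ 4 * ((3⁻¹ : ℝ≥0∞) ^ (N + 1) / (L : ℝ≥0∞) ^ 4) := by
            gcongr
            · exact_mod_cast Nat.one_le_iff_ne_zero.2 hL
            · norm_num
        _ = (3⁻¹ : ℝ≥0∞) ^ (N + 1) := ENNReal.mul_div_cancel (by simp [hL]) (by simp)
    calc μ (⋃ N, ⋃ s ∈ Finset.range L ×ˢ Finset.range L, badBox r L A N s)
        ≤ ∑' N, (3⁻¹ : ℝ≥0∞) ^ (N + 1) :=
          (measure_iUnion_le _).trans (ENNReal.tsum_le_tsum each)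
      -- The series equals `1 / 2`, which leaves positive probability for the good event.
      _ = 3⁻¹ * (1 - 3⁻¹)⁻¹ := by
          simp only [pow_succ', ENNReal.tsum_mul_left, ENNReal.tsum_geometric]
      _ < 1 := by
          rw [← div_eq_mul_inv]
          refine ENNReal.div_lt_of_lt_mul ?_
          rw [one_mul]
          refine lt_tsub_iff_right.2 ?_
          rw [← two_mul, ← div_eq_mul_inv]
          refine ENNReal.div_lt_of_lt_mul ?_
          norm_num
  rw [pos_iff_ne_zero]
  intro h0
  have huniv : μ Set.univ ≤ μ (⋃ N, ⋃ s ∈ Finset.range L ×ˢ Finset.range L, badBox r L A N s) +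
      μ {ω | ∀ N i j, i < L → j < L → ω ∉ badBox r L A N (i, j)} := by
    refine (measure_mono fun ω _ => ?_).trans (measure_union_le _ _)
    by_cases h : ∀ N i j, i < L → j < L → ω ∉ badBox r L A N (i, j)
    · exact Or.inr h
    · push Not at h
      obtain ⟨N, i, j, hi, hj, h⟩ := h
      refine Or.inl ?_
      simp only [Set.mem_iUnion]
      exact ⟨N, (i, j), by simp [hi, hj], h⟩
  rw [h0, add_zero, measure_univ] at huniv
  exact absurd hsum (not_lt.2 huniv)

end RenormalisationProbability

/-! ### Open clusters as reachability in a graph. -/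

section OpenGraph

variable {n : ℕ}

/-- The graph formed by the edges of the lattice whose endpoints are both open. -/
def openGraph (η : (Fin n → ℤ) → Bool) : SimpleGraph (Fin n → ℤ) where
  Adj x y := (lattice n).Adj x y ∧ η x = true ∧ η y = true
  symm := ⟨fun _ _ h => ⟨h.1.symm, h.2.2, h.2.1⟩⟩
  loopless := ⟨fun _ h => h.1.ne rfl⟩

theorem openGraph_le (η : (Fin n → ℤ) → Bool) : openGraph η ≤ lattice n := fun _ _ h => h.1

theorem open_of_mem_support {η : (Fin n → ℤ) → Bool} {x y : Fin n → ℤ}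
    (w : (openGraph η).Walk x y) (hx : η x = true) : ∀ z ∈ w.support, η z = true := by
  induction w with
  | nil => simpa using hx
  | cons h w ih =>
    intro z hz
    rw [SimpleGraph.Walk.support_cons, List.mem_cons] at hz
    rcases hz with rfl | hz
    · exact hx
    · exact ih h.2.2 z hz

/-- Reachability is reflexive even at closed sites, which is why `x` must be assumed open. -/
theorem mem_cluster_of_reachable {η : (Fin n → ℤ) → Bool} {x y : Fin n → ℤ} (hx : η x = true)
    (h : (openGraph η).Reachable x y) : y ∈ cluster η x := by
  classical
  obtain ⟨w⟩ := h
  refine ⟨w.bypass.mapLe (openGraph_le η), (SimpleGraph.Walk.isPath_mapLe _).2 w.bypass_isPath, ?_⟩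
  rw [SimpleGraph.Walk.support_mapLe_eq_support]
  exact open_of_mem_support _ hx

theorem lattice_adj_iff_sub {x y z : Fin n → ℤ} :
    (lattice n).Adj (x + y) (x + z) ↔ ∑ i, |y i - z i| = 1 := by
  simp [lattice]

/-- A cube of open sites is connected. -/
theorem reachable_of_cube_open {η : (Fin n → ℤ) → Bool} {b : Fin n → ℤ} {l : ℤ}
    (h : ∀ v : Fin n → ℤ, (∀ i, 0 ≤ v i ∧ v i ≤ l) → η (b + v) = true) (m : ℕ) :
    ∀ v : Fin n → ℤ, (∀ i, 0 ≤ v i ∧ v i ≤ l) → ∑ i, v i = m →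
      (openGraph η).Reachable b (b + v) := by
  induction m with
  | zero =>
    intro v hv hs
    have : v = 0 := by
      funext i
      rw [Nat.cast_zero, Finset.sum_eq_zero_iff_of_nonneg fun i _ => (hv i).1] at hs
      exact hs i (Finset.mem_univ i)
    rw [this, add_zero]
  | succ m ih =>
    -- Lowering a positive coordinate stays in the cube and reduces the coordinate sum by one.
    intro v hv hs
    obtain ⟨i, hi⟩ : ∃ i, 0 < v i := by
      by_contra! h0
      have := Finset.sum_nonpos fun i (_ : i ∈ Finset.univ) => h0 i
      push_cast at hs
      omega
    have hv' : ∀ j, 0 ≤ (v - Pi.single i 1 : Fin n → ℤ) j ∧ (v - Pi.single i 1 : Fin n → ℤ) j ≤ l := by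
      intro j
      have := hv j
      by_cases hj : j = i
      · subst hj
        simp only [Pi.sub_apply, Pi.single_eq_same]
        omega
      · simpa [Pi.single_eq_of_ne hj] using this
    refine (ih (v - Pi.single i 1) hv' ?_).trans (SimpleGraph.Adj.reachable ⟨?_, h _ hv', h _ hv⟩)
    · simp [hs]
    · rw [lattice_adj_iff_sub]
      have e : ∀ j, |(v - Pi.single i 1 : Fin n → ℤ) j - v j| = if j = i then 1 else 0 := by
        intro j
        simp only [Pi.sub_apply, Pi.single_apply]
        split_ifs <;> simp
      rw [Finset.sum_congr rfl fun j _ => e j]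
      simp

end OpenGraph

/-! ### Cells in the lattice and their finite-range dependence. -/

section Cells

variable {n k : ℕ}

/-- The corner of a cell: the lattice point `a • (1, …, 1) + b • (0, 1, …, n - 1)`. -/
def corner (n : ℕ) (c : ℕ × ℕ) : Fin n → ℤ := fun i => c.1 + c.2 * (i : ℕ)

/-- The sites of a cell, relative to its corner. -/
noncomputable def cube (n : ℕ) : Finset (Fin n → ℤ) :=
  Fintype.piFinset fun _ => Finset.Icc 0 (n : ℤ)

theorem mem_cube {v : Fin n → ℤ} : v ∈ cube n ↔ ∀ i, 0 ≤ v i ∧ v i ≤ n := by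
  simp [cube, Fintype.mem_piFinset]

/-- The event that some site of a cell is closed. -/
def closedCell (n k : ℕ) (c : ℕ × ℕ) : Set ((I : Index n k) → CoordPlane I.1 → Bool) :=
  ⋃ I : Index n k, ⋃ v ∈ cube n, {ω | ω I (proj I.1 (corner n c + v)) = false}

/-- The variables on which the state of a cell depends. -/
def cellSites (n k : ℕ) (c : ℕ × ℕ) : Set (Σ I : Index n k, CoordPlane I.1) :=
  {j | ∃ v ∈ cube n, j.2 = proj j.1.1 (corner n c + v)}

theorem config_eq_true_of_not_mem_closedCell
    {ω : (I : Index n k) → CoordPlane I.1 → Bool} {c : ℕ × ℕ} (h : ω ∉ closedCell n k c)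
    (v : Fin n → ℤ) (hv : ∀ i, 0 ≤ v i ∧ v i ≤ n) : config ω (corner n c + v) = true := by
  simp only [closedCell, Set.mem_iUnion, not_exists] at h
  simp only [config, decide_eq_true_eq]
  intro I
  exact Bool.eq_true_of_not_eq_false (h I v (mem_cube.2 hv))

theorem corner_succ_left (a b : ℕ) : corner n (a + 1, b) = corner n (a, b) + fun _ => 1 := by
  funext i
  simp only [corner, Pi.add_apply]
  push_cast
  ring

theorem corner_succ_right (a b : ℕ) :
    corner n (a, b + 1) = corner n (a, b) + fun i : Fin n => ((i : ℕ) : ℤ) := by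
  funext i
  simp only [corner, Pi.add_apply]
  push_cast
  ring

theorem reachable_corner {ω : (I : Index n k) → CoordPlane I.1 → Bool} {c : ℕ × ℕ}
    (h : ω ∉ closedCell n k c) (v : Fin n → ℤ) (hv : ∀ i, 0 ≤ v i ∧ v i ≤ n) :
    (openGraph (config ω)).Reachable (corner n c) (corner n c + v) := by
  refine reachable_of_cube_open (config_eq_true_of_not_mem_closedCell h) (∑ i, v i).toNat v hv ?_
  rw [Int.toNat_of_nonneg (Finset.sum_nonneg fun i _ => (hv i).1)]

/-- The range of dependence between cells. -/
def depRange (n : ℕ) : ℕ := 2 * n * n + n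

/-- A shared variable equates two coordinates of sites in the two cells. The difference of these
equations bounds the gap in `b` by `2n`, and then one of them bounds the gap in `a` by `2n * n + n`.
-/
theorem disjoint_cellSites (hk : 2 ≤ k) (x y : ℕ × ℕ) (h : Far (depRange n) x y) :
    Disjoint (cellSites n k x) (cellSites n k y) := by
  rw [Set.disjoint_left]
  rintro ⟨I, u⟩ ⟨v, hv, e⟩ ⟨w, hw, e'⟩
  rw [mem_cube] at hv hw
  obtain ⟨i, hi, j, hj, hij⟩ := Finset.one_lt_card.1 (show 1 < I.1.card by rw [I.2]; omega)
  have key : ∀ i ∈ I.1, (x.1 : ℤ) + x.2 * (i : ℕ) + v i = y.1 + y.2 * (i : ℕ) + w i := by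
    intro i hi
    have := congrFun (congrArg Subtype.val (e.symm.trans e')) i
    simpa [proj, hi, corner] using this
  have key2 : ∀ i j : Fin n, i < j → i ∈ I.1 → j ∈ I.1 → False := by
    intro i j hij hi hj
    have k1 := key i hi
    have k2 := key j hj
    have v1 := hv i
    have v2 := hv j
    have w1 := hw i
    have w2 := hw j
    have hd : (1 : ℤ) ≤ (j : ℕ) - (i : ℕ) := by
      have : (i : ℕ) < (j : ℕ) := hij
      omega
    have hin : ((i : ℕ) : ℤ) ≤ n := by exact_mod_cast i.2.le
    have hi0 : (0 : ℤ) ≤ (i : ℕ) := by positivity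
    obtain ⟨x1, x2⟩ := x
    obtain ⟨y1, y2⟩ := y
    have e2 : ((x2 : ℤ) - y2) * ((j : ℕ) - (i : ℕ)) = w j - v j - (w i - v i) := by
      simp only at k1 k2
      linear_combination k2 - k1
    have b1 : (x2 : ℤ) - y2 ≤ 2 * n := by
      by_contra! hlt
      nlinarith
    have b2 : -(2 * n : ℤ) ≤ (x2 : ℤ) - y2 := by
      by_contra! hlt
      nlinarith
    have e1 : (x1 : ℤ) - y1 = w i - v i - ((x2 : ℤ) - y2) * (i : ℕ) := by
      simp only at k1 k2
      linear_combination k1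
    have c1 : ((x2 : ℤ) - y2) * (i : ℕ) ≤ 2 * n * n := by nlinarith
    have c2 : -(2 * n * n : ℤ) ≤ ((x2 : ℤ) - y2) * (i : ℕ) := by nlinarith
    -- That is, `2n ≤ depRange n`, so the bound on the second index also contradicts `Far`.
    have c3 : (0 : ℤ) ≤ 2 * n * n - 2 * n + n := by
      rcases Nat.eq_zero_or_pos n with h0 | h0
      · simp [h0]
      · have : (1 : ℤ) ≤ n := by exact_mod_cast h0
        nlinarith
    simp only [Far, depRange] at h
    zify at h
    rcases h with h | h | h | h <;> linarith
  rcases lt_or_gt_of_ne hij with h' | h'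
  · exact key2 i j h' hi hj
  · exact key2 j i h' hj hi

/-- If no sub-box of the origin's boxes is bad, the origin percolates. -/
theorem cluster_infinite_of_good (hn : 0 < n) {L : ℕ} (hL : L = 2 * depRange n + 3)
    {ω : (I : Index n k) → CoordPlane I.1 → Bool}
    (h : ∀ N i j, i < L → j < L → ω ∉ badBox (depRange n) L (closedCell n k) N (i, j)) :
    (cluster (config ω) 0).Infinite := by
  have hG := fun N x => not_mem_badBox_succ (r := depRange n) (L := L) (A := closedCell n k)
    (ω := ω) N x
  have hC : Equivalence fun c c' : ℕ × ℕ =>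
      (openGraph (config ω)).Reachable (corner n c) (corner n c') :=
    ⟨fun _ => .refl _, fun h => h.symm, fun h h' => h.trans h'⟩
  have h0 : corner n (0, 0) = 0 := by
    funext i
    simp [corner]
  have key := fun N => origin_connected_rep
    (G := fun N x => ω ∉ badBox (depRange n) L (closedCell n k) N x) hL hG hC
    (fun a b h1 _ => by
      rw [corner_succ_left]
      exact reachable_corner h1 _ fun i => ⟨by simp, by simp; omega⟩)
    (fun a b h1 _ => by
      rw [corner_succ_right]
      exact reachable_corner h1 _ fun i => ⟨by simp, by simp⟩) h N 1 0
      (by omega) (by omega)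
  have hopen : config ω (0 : Fin n → ℤ) = true := by
    have := config_eq_true_of_not_mem_closedCell (h 0 0 0 (by omega) (by omega)) 0 (by simp)
    rwa [h0, add_zero] at this
  rw [h0] at key
  -- Coordinate `0` of a corner is its first index, which for the representative of box `(1, 0)` at
  -- level `N` is at least `L ^ N`.
  refine Set.Infinite.of_image (fun v : Fin n → ℤ => v ⟨0, hn⟩) ?_
  have hne : ((fun v : Fin n → ℤ => v ⟨0, hn⟩) '' cluster (config ω) 0).Nonempty :=
    ⟨_, _, mem_cluster_of_reachable hopen (key 0), rfl⟩
  refine Set.infinite_of_forall_exists_gt fun a => ?_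
  refine ⟨_, ⟨_, mem_cluster_of_reachable hopen (key a.toNat), rfl⟩, ?_⟩
  have hbox := rep_mem_box (L := L) (G := fun N x =>
    ω ∉ badBox (depRange n) L (closedCell n k) N x) a.toNat (1, 0)
  have hlt : a.toNat < L ^ a.toNat := Nat.lt_pow_self (by omega)
  simp only [mul_one] at hbox
  simp only [corner, Nat.cast_zero, mul_zero, add_zero]
  omega

end Cells

/-! ### Percolation at densities close to one. -/

section Supercritical

open scoped ENNReal

variable {n k : ℕ}

/-- The joint law of the percolations on the coordinate planes. -/
noncomputable abbrev fieldLaw (p : Index n k → unitInterval) :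
    Measure ((I : Index n k) → CoordPlane I.1 → Bool) :=
  Measure.pi fun I : Index n k => sitePerc (CoordPlane I.1) (p I)

/-- A finite product of infinite products is a single product over pairs (plane, site). -/
theorem iIndepFun_fieldLaw (p : Index n k → unitInterval) :
    iIndepFun (fun (j : Σ I : Index n k, CoordPlane I.1)
      (ω : (I : Index n k) → CoordPlane I.1 → Bool) => ω j.1 j.2) (fieldLaw p) := by
  rw [fieldLaw, ← Measure.infinitePi_eq_pi]
  exact iIndepFun_uncurry_infinitePi (X := fun _ _ b => b)
    (fun (I : Index n k) (_ : CoordPlane I.1) => bernoulliMeasure true false (p I))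
    fun _ _ => measurable_id

theorem fieldLaw_preimage (p : Index n k → unitInterval) (I : Index n k) (u : CoordPlane I.1)
    (s : Set Bool) : fieldLaw p {ω | ω I u ∈ s} = bernoulliMeasure true false (p I) s := by
  have h1 := measurePreserving_eval (fun I : Index n k => sitePerc (CoordPlane I.1) (p I)) I
  have h2 := measurePreserving_eval_infinitePi
    (fun _ : CoordPlane I.1 => bernoulliMeasure true false (p I)) u
  exact (h2.comp h1).measure_preimage (MeasurableSet.of_discrete (s := s)).nullMeasurableSet

theorem fieldLaw_closed (p : Index n k → unitInterval) (I : Index n k) (u : CoordPlane I.1) :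
    fieldLaw p {ω | ω I u = false} = ENNReal.ofReal (1 - p I) := by
  have := fieldLaw_preimage p I u {false}
  simp only [Set.mem_singleton_iff] at this
  rw [this, ← bernoulliMeasure_real_apply_of_notMem_of_mem (x := true) (y := false) (p I)
    (MeasurableSet.singleton false) (by simp) (by simp), ofReal_measureReal]

theorem fieldLaw_open (p : Index n k → unitInterval) (I : Index n k) (u : CoordPlane I.1) :
    fieldLaw p {ω | ω I u = true} = ENNReal.ofReal (p I) := by
  have := fieldLaw_preimage p I u {true}
  simp only [Set.mem_singleton_iff] at this
  rw [this, ← bernoulliMeasure_real_apply_of_mem_of_notMem (x := true) (y := false) (p I)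
    (MeasurableSet.singleton true) (by simp) (by simp), ofReal_measureReal]

theorem measure_closedCell_le {p : Index n k → unitInterval} {ε : ℝ}
    (h : ∀ I, 1 - ε < (p I : ℝ)) (c : ℕ × ℕ) :
    fieldLaw p (closedCell n k c) ≤
      (Fintype.card (Index n k) * (cube n).card : ℕ) * ENNReal.ofReal ε := by
  calc fieldLaw p (closedCell n k c)
      ≤ ∑ _I : Index n k, ∑ _v ∈ cube n, ENNReal.ofReal ε := by
        refine (measure_iUnion_fintype_le _ _).trans (Finset.sum_le_sum fun I _ => ?_)
        refine (measure_biUnion_finset_le _ _).trans (Finset.sum_le_sum fun v _ => ?_)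
        rw [fieldLaw_closed]
        exact ENNReal.ofReal_le_ofReal (by linarith [h I])
    _ = _ := by
        simp only [Finset.sum_const, Finset.card_univ, nsmul_eq_mul, Nat.cast_mul, mul_assoc]

theorem measurableSet_closedCell (c : ℕ × ℕ) :
    MeasurableSet[⨆ j ∈ cellSites n k c, MeasurableSpace.comap
      (fun ω : (I : Index n k) → CoordPlane I.1 → Bool => ω j.1 j.2) inferInstance]
      (closedCell n k c) := by
  refine MeasurableSet.iUnion fun I => Finset.measurableSet_biUnion _ fun v hv => ?_
  have hj : (⟨I, proj I.1 (corner n c + v)⟩ : Σ I : Index n k, CoordPlane I.1) ∈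
      cellSites n k c := ⟨v, hv, rfl⟩
  exact le_biSup (fun j : Σ I : Index n k, CoordPlane I.1 => MeasurableSpace.comap
    (fun ω : (I : Index n k) → CoordPlane I.1 → Bool => ω j.1 j.2) inferInstance) hj _
    ⟨{false}, MeasurableSet.singleton false, rfl⟩

theorem exists_forall_law_pos (hn : 0 < n) (hk : 2 ≤ k) :
    ∃ ε : ℝ, 0 < ε ∧ ∀ p : Index n k → unitInterval, (∀ I, 1 - ε < (p I : ℝ)) →
      0 < law p (originToInfinity n) := by
  obtain ⟨L, hL⟩ : ∃ L, L = 2 * depRange n + 3 := ⟨_, rfl⟩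
  obtain ⟨K, hK⟩ : ∃ K, K = Fintype.card (Index n k) * (cube n).card := ⟨_, rfl⟩
  -- A cell involves at most `K` variables, so this value gives `L ^ 4 * K * ε ≤ 1 / 3`; the `+ 1`
  -- keeps the denominator positive.
  refine ⟨(3 * (L ^ 4 * K + 1) : ℝ)⁻¹, by positivity, fun p hp => ?_⟩
  -- This inequality needs no measurability of the event, unlike the upper bound in the subcritical
  -- case.
  refine lt_of_lt_of_le ?_ (Measure.le_map_apply measurable_config.aemeasurable _)
  refine lt_of_lt_of_le (measure_forall_good_pos (L := L) (r := depRange n) (A := closedCell n k)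
    (S := cellSites n k) (fun j => ?_) (iIndepFun_fieldLaw p).iIndep measurableSet_closedCell
    (disjoint_cellSites hk) (fun x => ?_) (by omega)) (measure_mono fun ω hω => ?_)
  · have hm : Measurable fun ω : (I : Index n k) → CoordPlane I.1 → Bool => ω j.1 j.2 :=
      (measurable_pi_apply j.2).comp (measurable_pi_apply j.1)
    exact hm.comap_le
  · refine (mul_le_mul_right (measure_closedCell_le hp x) _).trans ?_
    rw [← hK]
    have e : (L : ℝ≥0∞) ^ 4 * (K * ENNReal.ofReal (3 * (L ^ 4 * K + 1) : ℝ)⁻¹) =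
        ENNReal.ofReal (L ^ 4 * (K * (3 * (L ^ 4 * K + 1) : ℝ)⁻¹)) := by
      rw [ENNReal.ofReal_mul (by positivity), ENNReal.ofReal_mul (by positivity),
        ENNReal.ofReal_pow (by positivity), ENNReal.ofReal_natCast, ENNReal.ofReal_natCast]
    have e3 : (3⁻¹ : ℝ≥0∞) = ENNReal.ofReal 3⁻¹ := by
      rw [ENNReal.ofReal_inv_of_pos (by norm_num)]
      norm_num
    rw [e, e3]
    refine ENNReal.ofReal_le_ofReal ?_
    have hpos : (0 : ℝ) < L ^ 4 * K + 1 := by positivity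
    rw [← mul_assoc, ← div_eq_mul_inv, div_le_iff₀ (by positivity)]
    linarith
  · exact cluster_infinite_of_good hn hL hω

end Supercritical

/-! ### Measurability of the percolation event. -/

section Measurability

variable {n : ℕ}

theorem measurableSet_forall_mem_list (l : List (Fin n → ℤ)) :
    MeasurableSet {η : (Fin n → ℤ) → Bool | ∀ z ∈ l, η z = true} := by
  have : {η : (Fin n → ℤ) → Bool | ∀ z ∈ l, η z = true} =
      ⋂ z ∈ {z | z ∈ l}, {η : (Fin n → ℤ) → Bool | η z = true} := by
    ext η
    simp
  rw [this]
  exact MeasurableSet.biInter l.finite_toSet.countable fun z _ =>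
    (measurable_pi_apply (X := fun _ : Fin n → ℤ => Bool) z) (MeasurableSet.singleton true)

/-- Openness of a path depends only on its list of vertices, and there are countably many finite
lists. -/
theorem measurableSet_mem_cluster (x y : Fin n → ℤ) :
    MeasurableSet {η : (Fin n → ℤ) → Bool | y ∈ cluster η x} := by
  have : {η : (Fin n → ℤ) → Bool | y ∈ cluster η x} = ⋃ l : List (Fin n → ℤ),
      {η | (∃ w : (lattice n).Walk x y, w.IsPath ∧ w.support = l) ∧ ∀ z ∈ l, η z = true} := by
    ext η
    simp only [Set.mem_iUnion]
    constructor
    · rintro ⟨w, hw, h⟩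
      exact ⟨w.support, ⟨w, hw, rfl⟩, h⟩
    · rintro ⟨l, ⟨w, hw, rfl⟩, h⟩
      exact ⟨w, hw, h⟩
  rw [this]
  refine MeasurableSet.iUnion fun l => ?_
  by_cases h : ∃ w : (lattice n).Walk x y, w.IsPath ∧ w.support = l
  · simp only [h, true_and]
    exact measurableSet_forall_mem_list l
  · simp only [h, false_and, Set.ofPred_false, MeasurableSet.empty]

theorem measurableSet_originToInfinity (n : ℕ) : MeasurableSet (originToInfinity n) := by
  have : originToInfinity n =
      ⋂ s : Finset (Fin n → ℤ), ⋃ y : Fin n → ℤ, {η | y ∉ s ∧ y ∈ cluster η 0} := by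
    ext η
    simp only [Set.mem_iInter, Set.mem_iUnion]
    constructor
    · intro h s
      obtain ⟨y, hy, hys⟩ := Set.Infinite.exists_notMem_finset h s
      exact ⟨y, hys, hy⟩
    · intro h hfin
      obtain ⟨y, hy, hy'⟩ := h hfin.toFinset
      exact hy (hfin.mem_toFinset.2 hy')
  rw [this]
  refine MeasurableSet.iInter fun s => MeasurableSet.iUnion fun y => ?_
  by_cases h : y ∈ s
  · simp only [h, not_true, false_and, Set.ofPred_false, MeasurableSet.empty]
  · simp only [h, not_false_iff, true_and]
    exact measurableSet_mem_cluster 0 y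

end Measurability

/-! ### Projecting an infinite cluster to long paths in a plane. -/

section Paths

variable {n k : ℕ}

/-- The unit vector in a signed coordinate direction. -/
def stepVec (d : Fin n × Bool) : Fin n → ℤ := Pi.single d.1 (if d.2 then 1 else -1)

theorem exists_eq_add_stepVec {x y : Fin n → ℤ} (h : (lattice n).Adj x y) :
    ∃ d, y = x + stepVec d := by
  have h : ∑ i, |x i - y i| = 1 := h
  obtain ⟨i, hi⟩ : ∃ i, x i ≠ y i := by
    by_contra! h0
    simp [h0] at h
  have hsplit := Finset.add_sum_erase Finset.univ (fun i => |x i - y i|) (Finset.mem_univ i)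
  have hpos : 1 ≤ |x i - y i| := Int.one_le_abs (sub_ne_zero.2 hi)
  have hnn : ∀ j ∈ Finset.univ.erase i, 0 ≤ |x j - y j| := fun j _ => abs_nonneg _
  have hrest : ∑ j ∈ Finset.univ.erase i, |x j - y j| = 0 := by
    have := Finset.sum_nonneg hnn
    omega
  have hone : |x i - y i| = 1 := by
    omega
  have hoff : ∀ j, j ≠ i → y j = x j := by
    intro j hj
    have := (Finset.sum_eq_zero_iff_of_nonneg hnn).1 hrest j (by simp [hj])
    rw [abs_eq_zero] at this
    omega
  rcases (abs_eq (by norm_num)).1 hone with h1 | h1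
  · refine ⟨(i, false), funext fun j => ?_⟩
    by_cases hj : j = i
    · subst hj
      simp [stepVec]
      omega
    · simp [stepVec, Pi.single_eq_of_ne hj, hoff j hj]
  · refine ⟨(i, true), funext fun j => ?_⟩
    by_cases hj : j = i
    · subst hj
      simp [stepVec]
      omega
    · simp [stepVec, Pi.single_eq_of_ne hj, hoff j hj]

/-- The position after `j` steps of the walk from the origin with the given directions. -/
def site {m : ℕ} (f : Fin m → Fin n × Bool) (j : ℕ) : Fin n → ℤ :=
  ∑ i ∈ Finset.range j, if h : i < m then stepVec (f ⟨i, h⟩) else 0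

theorem site_succ {m : ℕ} (f : Fin m → Fin n × Bool) {j : ℕ} (h : j < m) :
    site f (j + 1) = site f j + stepVec (f ⟨j, h⟩) := by
  rw [site, Finset.sum_range_succ, dif_pos h, site]

theorem abs_sub_le_length {η : (Fin n → ℤ) → Bool} {x y : Fin n → ℤ}
    (w : (openGraph η).Walk x y) (i : Fin n) : |x i - y i| ≤ w.length := by
  induction w with
  | nil => simp
  | @cons x z y h w ih =>
    have h1 : |x i - z i| ≤ 1 := by
      have h : ∑ i, |x i - z i| = 1 := h.1
      rw [← h]
      exact Finset.single_le_sum (f := fun i => |x i - z i|) (fun j _ => abs_nonneg _)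
        (Finset.mem_univ i)
    have := abs_sub_le (x i) (z i) (y i)
    rw [SimpleGraph.Walk.length_cons]
    push_cast
    linarith

/-- The configuration on the coordinate plane `I`, extended by closed sites. -/
def planeConfig (I : Index n k) (ω : (I : Index n k) → CoordPlane I.1 → Bool)
    (v : Fin n → ℤ) : Bool :=
  decide (∀ i, i ∉ I.1 → v i = 0) && ω I (proj I.1 v)

theorem planeConfig_eq_true {I : Index n k} {ω : (I : Index n k) → CoordPlane I.1 → Bool}
    {v : Fin n → ℤ} :
    planeConfig I ω v = true ↔ (∀ i, i ∉ I.1 → v i = 0) ∧ ω I (proj I.1 v) = true := by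
  simp [planeConfig]

theorem proj_proj (I : Finset (Fin n)) (v : Fin n → ℤ) : proj I (proj I v).1 = proj I v := by
  ext i
  simp +contextual [proj]

theorem eq_of_proj_eq {I : Finset (Fin n)} {v w : Fin n → ℤ} (hv : ∀ i, i ∉ I → v i = 0)
    (hw : ∀ i, i ∉ I → w i = 0) (h : proj I v = proj I w) : v = w := by
  funext i
  by_cases hi : i ∈ I
  · simpa [proj, hi] using congrFun (congrArg Subtype.val h) i
  · rw [hv i hi, hw i hi]

theorem planeConfig_proj {I : Index n k} {ω : (I : Index n k) → CoordPlane I.1 → Bool}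
    {v : Fin n → ℤ} (h : config ω v = true) : planeConfig I ω (proj I.1 v).1 = true := by
  rw [planeConfig_eq_true, proj_proj]
  simp only [config, decide_eq_true_eq] at h
  exact ⟨(proj I.1 v).2, h I⟩

/-- An edge in a direction outside `I` collapses to a point, and any other edge projects to an edge.
-/
theorem reachable_proj {I : Index n k} {ω : (I : Index n k) → CoordPlane I.1 → Bool}
    {x y : Fin n → ℤ} (w : (lattice n).Walk x y) (h : ∀ z ∈ w.support, config ω z = true) :
    (openGraph (planeConfig I ω)).Reachable (proj I.1 x).1 (proj I.1 y).1 := by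
  induction w with
  | nil => exact .refl _
  | @cons x z y hxz w ih =>
    have hx : config ω x = true := h x (by simp)
    have hz : config ω z = true := h z (by simp)
    refine SimpleGraph.Reachable.trans ?_ (ih fun t ht => h t (by simp [ht]))
    by_cases he : (proj I.1 x).1 = (proj I.1 z).1
    · rw [he]
    refine SimpleGraph.Adj.reachable ⟨?_, planeConfig_proj hx, planeConfig_proj hz⟩
    have hle : ∑ i, |(proj I.1 x).1 i - (proj I.1 z).1 i| ≤ 1 := by
      have hxz : ∑ i, |x i - z i| = 1 := hxz
      rw [← hxz]
      refine Finset.sum_le_sum fun i _ => ?_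
      by_cases hi : i ∈ I.1 <;> simp [proj, hi]
    obtain ⟨i, hi⟩ : ∃ i, (proj I.1 x).1 i ≠ (proj I.1 z).1 i := by
      by_contra! h0
      exact he (funext h0)
    have hge : 1 ≤ ∑ i, |(proj I.1 x).1 i - (proj I.1 z).1 i| :=
      (Int.one_le_abs (sub_ne_zero.2 hi)).trans (Finset.single_le_sum
        (f := fun i => |(proj I.1 x).1 i - (proj I.1 z).1 i|) (fun j _ => abs_nonneg _)
        (Finset.mem_univ i))
    exact le_antisymm hle hge

/-- An infinite cluster projects to arbitrarily long open self-avoiding paths in some plane. -/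
theorem exists_plane_paths (hk : 0 < k) (hkn : k ≤ n)
    {ω : (I : Index n k) → CoordPlane I.1 → Bool} (h : (cluster (config ω) 0).Infinite) :
    ∃ I : Index n k, ∀ m, ∃ f : Fin m → Fin n × Bool,
      Set.InjOn (fun j => proj I.1 (site f j)) (Finset.range (m + 1)) ∧
      ∀ j ∈ Finset.range (m + 1), ω I (proj I.1 (site f j)) = true := by
  classical
  obtain ⟨i, hi⟩ : ∃ i : Fin n, ((fun v : Fin n → ℤ => v i) '' cluster (config ω) 0).Infinite := by
    by_contra! h0
    refine h ((Set.Finite.pi' fun i => h0 i).subset fun v hv i => ?_)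
    exact ⟨v, hv, rfl⟩
  -- Any plane containing the unbounded direction `i` retains the unboundedness of the cluster.
  obtain ⟨I, hI, hIc⟩ := Finset.exists_superset_card_eq (s := {i}) (n := k)
    (by simpa using Nat.succ_le_of_lt hk) (by simpa using hkn)
  have hiI : i ∈ I := hI (by simp)
  refine ⟨⟨I, hIc⟩, fun m => ?_⟩
  obtain ⟨a, ⟨y, hy, rfl⟩, ha⟩ := hi.exists_notMem_finite (Set.finite_Icc (-m : ℤ) m)
  obtain ⟨w, -, hw⟩ := hy
  obtain ⟨w'⟩ := reachable_proj (I := ⟨I, hIc⟩) w hw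
  have hopen0 : planeConfig ⟨I, hIc⟩ ω (proj I 0).1 = true := planeConfig_proj (hw 0 (by simp))
  have hm : m ≤ w'.bypass.length := by
    have := abs_sub_le_length w'.bypass i
    have e0 : (proj I (0 : Fin n → ℤ)).1 i = 0 := by simp [proj]
    have e1 : (proj I y).1 i = y i := by simp [proj, hiI]
    simp only [e0, e1, zero_sub, abs_neg] at this
    have hlt : (m : ℤ) < |y i| := by
      rw [← not_le, abs_le]
      exact ha
    omega
  have hstep : ∀ j : Fin m, ∃ d,
      w'.bypass.getVert (j + 1) = w'.bypass.getVert j + stepVec d := fun j =>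
    exists_eq_add_stepVec (w'.bypass.adj_getVert_succ (by omega)).1
  choose f hf using hstep
  have hsite : ∀ j ≤ m, site f j = w'.bypass.getVert j := by
    intro j
    induction j with
    | zero =>
      intro _
      rw [SimpleGraph.Walk.getVert_zero]
      funext i
      simp [site, proj]
    | succ j ih =>
      intro hj
      rw [site_succ f hj, ih (by omega), hf ⟨j, hj⟩]
  -- The path stays in the plane because sites off it are closed in `planeConfig`; hence `proj` is
  -- injective along the path.
  have hplane : ∀ j ≤ m, (∀ i, i ∉ I → site f j i = 0) ∧ ω ⟨I, hIc⟩ (proj I (site f j)) = true := by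
    intro j hj
    rw [hsite j hj]
    exact planeConfig_eq_true.1
      (open_of_mem_support w'.bypass hopen0 _ (w'.bypass.getVert_mem_support j))
  refine ⟨f, ?_, fun j hj => (hplane j (by simpa [Nat.lt_succ_iff] using hj)).2⟩
  intro a ha b hb hab
  simp only [Finset.coe_range, Set.mem_Iio, Nat.lt_succ_iff] at ha hb
  have := eq_of_proj_eq (hplane a ha).1 (hplane b hb).1 hab
  rw [hsite a ha, hsite b hb] at this
  exact w'.bypass_isPath.getVert_injOn (ha.trans hm) (hb.trans hm) this

end Paths

/-! ### Path counting at low densities. -/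

section Subcritical

open scoped ENNReal

variable {n k : ℕ}

theorem measure_path_open_le (p : Index n k → unitInterval) (I : Index n k) {m : ℕ}
    (f : Fin m → Fin n × Bool)
    (hf : Set.InjOn (fun j => proj I.1 (site f j)) (Finset.range (m + 1))) :
    fieldLaw p {ω | ∀ j ∈ Finset.range (m + 1), ω I (proj I.1 (site f j)) = true} ≤
      ENNReal.ofReal (p I) ^ m := by
  classical
  set g : ℕ → Σ I : Index n k, CoordPlane I.1 := fun j => ⟨I, proj I.1 (site f j)⟩ with hg
  have hgi : Set.InjOn g (Finset.range (m + 1)) := by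
    intro a ha b hb hab
    refine hf ha hb ?_
    simpa [hg] using hab
  have hprod := (iIndepFun_fieldLaw p).measure_inter_preimage_eq_mul
    ((Finset.range (m + 1)).image g) (sets := fun _ => {true}) fun _ _ => MeasurableSet.singleton _
  rw [Finset.prod_image hgi] at hprod
  have hset : {ω : (I : Index n k) → CoordPlane I.1 → Bool |
      ∀ j ∈ Finset.range (m + 1), ω I (proj I.1 (site f j)) = true} =
      ⋂ j ∈ (Finset.range (m + 1)).image g,
        (fun ω : (I : Index n k) → CoordPlane I.1 → Bool => ω j.1 j.2) ⁻¹' {true} := by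
    ext ω
    simp [hg]
  rw [hset, hprod]
  have hone : ∀ j, fieldLaw p ((fun ω : (I : Index n k) → CoordPlane I.1 → Bool =>
      ω (g j).1 (g j).2) ⁻¹' {true}) = ENNReal.ofReal (p I) := fun j =>
    fieldLaw_open p I (proj I.1 (site f j))
  rw [Finset.prod_congr rfl fun j _ => hone j, Finset.prod_const, Finset.card_range, pow_succ]
  -- One of the `m + 1` factors is discarded so that the exponent matches the `m` steps counted
  -- later.
  exact mul_le_of_le_one_right' (ENNReal.ofReal_le_one.2 (p I).2.2)

theorem law_originToInfinity_eq_zero (hk : 0 < k) (hkn : k ≤ n) {p : Index n k → unitInterval}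
    (hp : ∀ I, (p I : ℝ) < (4 * n : ℝ)⁻¹) : law p (originToInfinity n) = 0 := by
  have hn : 0 < n := by omega
  rw [law, Measure.map_apply measurable_config (measurableSet_originToInfinity n)]
  have hsub : config ⁻¹' originToInfinity n ⊆ ⋃ I : Index n k, ⋂ m : ℕ,
      ⋃ f : Fin m → Fin n × Bool,
        {ω : (I : Index n k) → CoordPlane I.1 → Bool |
          Set.InjOn (fun j => proj I.1 (site f j)) (Finset.range (m + 1)) ∧
          ∀ j ∈ Finset.range (m + 1), ω I (proj I.1 (site f j)) = true} := by
    intro ω hω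
    obtain ⟨I, hI⟩ := exists_plane_paths hk hkn hω
    simp only [Set.mem_iUnion, Set.mem_iInter]
    exact ⟨I, hI⟩
  refine measure_mono_null hsub (measure_iUnion_null fun I => ?_)
  have bound : ∀ m : ℕ, fieldLaw p (⋂ m : ℕ, ⋃ f : Fin m → Fin n × Bool,
        {ω : (I : Index n k) → CoordPlane I.1 → Bool |
          Set.InjOn (fun j => proj I.1 (site f j)) (Finset.range (m + 1)) ∧
          ∀ j ∈ Finset.range (m + 1), ω I (proj I.1 (site f j)) = true}) ≤
      (2⁻¹ : ℝ≥0∞) ^ m := by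
    intro m
    refine (measure_mono (Set.iInter_subset _ m)).trans ?_
    calc fieldLaw p (⋃ f : Fin m → Fin n × Bool,
        {ω : (I : Index n k) → CoordPlane I.1 → Bool |
          Set.InjOn (fun j => proj I.1 (site f j)) (Finset.range (m + 1)) ∧
          ∀ j ∈ Finset.range (m + 1), ω I (proj I.1 (site f j)) = true})
        ≤ ∑ _f : Fin m → Fin n × Bool, ENNReal.ofReal (p I) ^ m := by
          refine (measure_iUnion_fintype_le _ _).trans (Finset.sum_le_sum fun f _ => ?_)
          by_cases hf : Set.InjOn (fun j => proj I.1 (site f j)) (Finset.range (m + 1))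
          · simp only [hf, true_and]
            exact measure_path_open_le p I f hf
          · simp only [hf, false_and, Set.ofPred_false, measure_empty]
            exact zero_le
      -- All `2n` signed directions are counted at each step, including those outside `I`; the crude
      -- count is enough.
      _ = (ENNReal.ofReal (n * 2) * ENNReal.ofReal (p I)) ^ m := by
          rw [mul_pow, Finset.sum_const, nsmul_eq_mul, Finset.card_univ, Fintype.card_fun,
            Fintype.card_prod, Fintype.card_fin, Fintype.card_fin, Fintype.card_bool,
            ENNReal.ofReal_mul (by positivity), ENNReal.ofReal_natCast]
          simp
      _ ≤ (2⁻¹ : ℝ≥0∞) ^ m := by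
          gcongr
          rw [← ENNReal.ofReal_mul (by positivity)]
          have e2 : (2⁻¹ : ℝ≥0∞) = ENNReal.ofReal 2⁻¹ := by
            rw [ENNReal.ofReal_inv_of_pos (by norm_num)]
            norm_num
          rw [e2]
          refine ENNReal.ofReal_le_ofReal ?_
          have hn' : (0 : ℝ) < n := by exact_mod_cast hn
          calc (n * 2 : ℝ) * p I ≤ n * 2 * (4 * n : ℝ)⁻¹ := by
                gcongr
                exact (hp I).le
            _ = 2⁻¹ := by
                field_simp
                norm_num
  exact le_antisymm (ge_of_tendsto' (ENNReal.tendsto_pow_atTop_nhds_zero_of_lt_one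
    (by simp)) bound) zero_le

end Subcritical

end HyperplanePercolation

/-! ### Both regimes and the phase transition. -/

theorem theoremt (n k : ℕ) (hn : 3 ≤ n) (hk : 2 ≤ k) (hkn : k ≤ n - 1) :
    HyperplanePercolation.NontrivialPhaseTransition n k ∧
    (∃ ε : ℝ, 0 < ε ∧ ∀ p : HyperplanePercolation.Index n k → unitInterval,
      (∀ I, 1 - ε < (p I : ℝ)) →
        0 < HyperplanePercolation.law p (HyperplanePercolation.originToInfinity n)) ∧
    (∃ ε : ℝ, 0 < ε ∧ ∀ p : HyperplanePercolation.Index n k → unitInterval,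
      (∀ I, (p I : ℝ) < ε) →
        HyperplanePercolation.law p (HyperplanePercolation.originToInfinity n) = 0) := by
  have hsup := HyperplanePercolation.exists_forall_law_pos (n := n) (k := k) (by omega) hk
  have hsub : ∃ ε : ℝ, 0 < ε ∧ ∀ p : HyperplanePercolation.Index n k → unitInterval,
      (∀ I, (p I : ℝ) < ε) →
        HyperplanePercolation.law p (HyperplanePercolation.originToInfinity n) = 0 :=
    ⟨(4 * n : ℝ)⁻¹, by
      have : (0 : ℝ) < n := by exact_mod_cast (by omega : 0 < n)
      positivity, fun p hp =>
      HyperplanePercolation.law_originToInfinity_eq_zero (by omega) (by omega) hp⟩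
  refine ⟨⟨?_, ?_⟩, hsup, hsub⟩
  · obtain ⟨ε, hε, h⟩ := hsub
    -- Halving `ε` gives the strict inequality, and the minimum with `1` keeps the parameter in the
    -- unit interval.
    have hpos : 0 < min (ε / 2) 1 := by positivity
    refine ⟨fun _ => ⟨min (ε / 2) 1, hpos.le, min_le_right _ _⟩, fun _ => hpos, h _ fun _ => ?_⟩
    exact (min_le_left _ _).trans_lt (by linarith)
  · obtain ⟨ε, hε, h⟩ := hsup
    have hpos : 0 < min (ε / 2) 1 := by positivity
    have hle := min_le_right (ε / 2) 1
    have hle' := min_le_left (ε / 2) 1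
    refine ⟨fun _ => ⟨1 - min (ε / 2) 1, by linarith, by linarith⟩, fun _ => ?_, h _ fun _ => ?_⟩
    · exact Subtype.mk_lt_mk.2 (by linarith)
    · show 1 - ε < 1 - min (ε / 2) 1
      linarith
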